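/- Let $n\ge 1$ and $\lambda\in[1/4,1)$. The 2-choice process with $n$ bins and $n$ generators evolves in rounds. At the start of a round every non-empty bin deletes one ball. Then each generator, independently of everything else, generates a ball with probability $\lambda$, and every generated ball draws two bins independently and uniformly at random (with replacement) and is placed into a least loaded one of the two. All balls of a round are placed in parallel, according to the loads right after the deletions; ties are resolved by the ordering of the bins by load (the bin with the larger index $i$ in a non-increasing ordering of the loads is taken), so that each ball falls into the $i$-th fullest bin with probability $(2i-1)/n^2$. The load vector $\boldsymbol X(t)=(X_1(t)\ge X_2(t)\ge\dots\ge X_n(t))\in\mathbb N^n$ lists the loads after round $t$ in non-increasing order. It is a time-homogeneous Markov chain $\boldsymbol X$ on the non-increasing vectors in $\mathbb N^n$. Call a state positive recurrent if the chain started in it returns to it with probability $1$ and the expected return time is finite. Then every state $x$ that is reachable from the empty system $(0,\dots,0)$ is positive recurrent, and the chain has a unique stationary distribution (unique among all probability distributions on the set of non-increasing vectors in $\mathbb N^n$). If $n\ge2$, the chain is moreover irreducible: every non-increasing vector in $\mathbb N^n$ is reachable from every other one, so that every state is positive recurrent. -/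

import Mathlib

namespace TwoChoice

/-- Load vectors of `n` bins: `x i` is the load of the `(i+1)`-st fullest bin, so the
entries are listed in non-increasing order. -/
abbrev LoadVector (n : ℕ) : Type := {x : Fin n → ℕ // Antitone x}

/-- The load vector of the empty system. -/
def emptySystem (n : ℕ) : LoadVector n := ⟨fun _ => 0, fun _ _ _ => le_rfl⟩

/-- The load vector of a configuration: its loads, sorted in non-increasing order. -/
def toLoadVector {n : ℕ} (z : Fin n → ℕ) : LoadVector n :=
  ⟨fun i => z (Tuple.sort z (Fin.rev i)),
    fun _ _ h => Tuple.monotone_sort z (Fin.rev_le_rev.mpr h)⟩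

/-- The random choices of one round: for each of the `n` generators, whether it generates a
ball, and the two bins that this ball queries (irrelevant if there is no ball). -/
abbrev Round (n : ℕ) : Type := Fin n → Bool × Fin n × Fin n

/-- A least loaded one of the bins `i` and `j` in the configuration `y`. Bins are numbered from
the fullest to the emptiest, and ties are broken in favour of the larger number. -/
def leastLoaded {n : ℕ} (y : Fin n → ℕ) (i j : Fin n) : Fin n :=
  if y i < y j then i else if y j < y i then j else max i j

/-- The loads after the deletions at the start of a round: each non-empty bin loses one ball. -/
def afterDeletion {n : ℕ} (x : LoadVector n) : Fin n → ℕ := fun i => x.1 i - 1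

/-- One round of the 2-choice process. All balls of the round are allocated in parallel,
according to the loads after the deletions. -/
def step {n : ℕ} (x : LoadVector n) (r : Round n) : LoadVector n :=
  toLoadVector fun i => afterDeletion x i +
    (Finset.univ.filter fun g : Fin n =>
      (r g).1 = true ∧ leastLoaded (afterDeletion x) (r g).2.1 (r g).2.2 = i).card

/-- The process started in `x`, driven by the choices `ω 0, ω 1, …` of the successive rounds:
`process x ω t` is the load vector after `t` rounds. -/
def process {n : ℕ} (x : LoadVector n) (ω : ℕ → Round n) : ℕ → LoadVector n
  | 0 => x
  | t + 1 => step (process x ω t) (ω t)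

/-- The law of one generator's choices: a ball is generated with probability `lam`, and,
independently, two bins are drawn independently and uniformly at random. -/
noncomputable def generatorLaw (n : ℕ) [NeZero n] (lam : unitInterval) :
    MeasureTheory.Measure (Bool × Fin n × Fin n) :=
  (ProbabilityTheory.bernoulliMeasure true false lam).prod
    ((PMF.uniformOfFintype (Fin n)).toMeasure.prod (PMF.uniformOfFintype (Fin n)).toMeasure)

/-- The law of the choices of one round; the generators are independent. -/
noncomputable def roundLaw (n : ℕ) [NeZero n] (lam : unitInterval) :
    MeasureTheory.Measure (Round n) :=
  MeasureTheory.Measure.pi fun _ : Fin n => generatorLaw n lam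

/-- The law of the choices of all rounds; the rounds are independent. -/
noncomputable def choicesLaw (n : ℕ) [NeZero n] (lam : unitInterval) :
    MeasureTheory.Measure (ℕ → Round n) :=
  MeasureTheory.Measure.infinitePi fun _ : ℕ => roundLaw n lam

/-- The transition probabilities of the Markov chain of load vectors. -/
noncomputable def transProb {n : ℕ} [NeZero n] (lam : unitInterval) (x y : LoadVector n) :
    ENNReal :=
  roundLaw n lam {r | step x r = y}

/-- `y` is reachable from `x` by finitely many transitions of positive probability. -/
def Reachable {n : ℕ} [NeZero n] (lam : unitInterval) (x y : LoadVector n) : Prop :=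
  Relation.ReflTransGen (fun u v : LoadVector n => 0 < transProb lam u v) x y

/-- The first time `t ≥ 1` at which the process started in `x` is back in `x`
(`⊤` if it never returns). -/
noncomputable def returnTime {n : ℕ} (x : LoadVector n) (ω : ℕ → Round n) : ℕ∞ :=
  ⨅ (t : ℕ) (_ : 1 ≤ t ∧ process x ω t = x), (t : ℕ∞)

/-- The state `x` is positive recurrent: the chain started in `x` returns to `x` with
probability one, and the expected return time is finite. -/
def PositiveRecurrent {n : ℕ} [NeZero n] (lam : unitInterval) (x : LoadVector n) : Prop :=
  choicesLaw n lam {ω | returnTime x ω < ⊤} = 1 ∧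
    ∫⁻ ω, (returnTime x ω : ENNReal) ∂(choicesLaw n lam) < ⊤

/-- `p` is a stationary distribution of the Markov chain of load vectors. -/
def Stationary {n : ℕ} [NeZero n] (lam : unitInterval) (p : PMF (LoadVector n)) : Prop :=
  ∀ y, ∑' x, p x * transProb lam x y = p y

end TwoChoice

/-! The proof is a Foster–Lyapunov argument with the sum of squared loads. Let y be the loads after
the deletions. The smaller of two loads is at most their average, so a ball raises the sum of
squares by at most the sum of the two queried loads, up to a collision term of at most n^3 per
round. In expectation a round thus adds at most 2λ Σ y_i + n^3, while the deletions remove at least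
2 Σ y_i. The drift is therefore at most 2n + n^3 - 2(1-λ)|x|, with |x| the total load
(`mulCol_sqLoad_add_le`), and a finite set of states of bounded total load is hit in finite expected
time.

`HasHittingBound.of_step` moves such a bound from a finite target to any target that it can enter in
one step. Rounds without balls shrink the target to the empty system, and a path of positive
probability carries it on to every reachable state. A bound for {x} is also a bound on the expected
return time to x. A bound for one state makes the occupation measure of its excursions finite;
normalised, this is the only stationary distribution.

Irreducibility is combinatorial: rounds without balls empty the system. Conversely, with n ≥ 2 one
bin can be filled to any height, and the other balls of a target are traced back, one at a time, to
the fullest bin. -/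

open scoped ENNReal

/-! ### Killed chains and hitting-time certificates. -/

namespace DiscreteChain

variable {S : Type*}

/-- The action of a non-negative matrix on row vectors (measures). -/
noncomputable def rowMul (Q : S → S → ℝ≥0∞) (p : S → ℝ≥0∞) (y : S) : ℝ≥0∞ := ∑' x, p x * Q x y

/-- The action of a non-negative matrix on column vectors (functions). -/
noncomputable def mulCol (Q : S → S → ℝ≥0∞) (f : S → ℝ≥0∞) (x : S) : ℝ≥0∞ := ∑' y, Q x y * f y

/-- The transition matrix `P`, killed on entering the set `A`. -/
noncomputable def taboo (P : S → S → ℝ≥0∞) (A : Set S) (x : S) : S → ℝ≥0∞ := Aᶜ.indicator (P x)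

/-- A Foster–Lyapunov certificate: a finite function `W` that bounds the expected time of the
first entry (at a time `≥ 1`) into `A`. -/
def HasHittingBound (P : S → S → ℝ≥0∞) (A : Set S) : Prop :=
  ∃ W : S → ℝ≥0∞, (∀ z, W z ≠ ⊤) ∧ ∀ z, 1 + mulCol (taboo P A) W z ≤ W z

lemma mulCol_mono (Q : S → S → ℝ≥0∞) {f g : S → ℝ≥0∞} (h : f ≤ g) : mulCol Q f ≤ mulCol Q g :=
  fun _ => ENNReal.tsum_le_tsum fun y => mul_le_mul_right (h y) _

lemma tsum_rowMul_mul (Q : S → S → ℝ≥0∞) (p f : S → ℝ≥0∞) :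
    ∑' y, rowMul Q p y * f y = ∑' x, p x * mulCol Q f x := by
  simp only [rowMul, mulCol, ← ENNReal.tsum_mul_left, ← ENNReal.tsum_mul_right]
  rw [ENNReal.tsum_comm]
  simp only [mul_assoc]

lemma tsum_rowMul_iterate_mul (Q : S → S → ℝ≥0∞) (p f : S → ℝ≥0∞) (t : ℕ) :
    ∑' y, (rowMul Q)^[t] p y * f y = ∑' x, p x * (mulCol Q)^[t] f x := by
  induction t generalizing p with
  | zero => rfl
  | succ t ih =>
    rw [Function.iterate_succ_apply, ih, tsum_rowMul_mul, Function.iterate_succ_apply']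

lemma tsum_rowMul_iterate (Q : S → S → ℝ≥0∞) (p : S → ℝ≥0∞) (t : ℕ) :
    ∑' y, (rowMul Q)^[t] p y = ∑' x, p x * (mulCol Q)^[t] (fun _ => 1) x := by
  simpa using tsum_rowMul_iterate_mul Q p (fun _ => 1) t

/-- The iterate `(mulCol Q)^[t] (fun _ => 1) z` is the probability that the killed chain from `z` is
still alive after `t` steps. The certificate inequality is exactly what one unrolled step of the
induction needs. -/
lemma sum_survival_le {Q : S → S → ℝ≥0∞} {W : S → ℝ≥0∞} (h : ∀ z, 1 + mulCol Q W z ≤ W z)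
    (N : ℕ) (z : S) : ∑ t ∈ Finset.range N, (mulCol Q)^[t] (fun _ => 1) z ≤ W z := by
  induction N generalizing z with
  | zero => simp
  | succ N ih =>
    rw [Finset.sum_range_succ']
    refine le_trans ?_ (h z)
    rw [add_comm]
    refine add_le_add le_rfl ?_
    calc ∑ t ∈ Finset.range N, (mulCol Q)^[t + 1] (fun _ => 1) z
        = mulCol Q (fun y => ∑ t ∈ Finset.range N, (mulCol Q)^[t] (fun _ => 1) y) z := by
          simp only [Function.iterate_succ_apply', mulCol, Finset.mul_sum]
          rw [Summable.tsum_finsetSum fun _ _ => ENNReal.summable]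
      _ ≤ mulCol Q W z := mulCol_mono Q ih z

/-- The expected time spent before entering `A` is bounded by the certificate. -/
lemma tsum_survival_le {Q : S → S → ℝ≥0∞} {W : S → ℝ≥0∞} (h : ∀ z, 1 + mulCol Q W z ≤ W z)
    (z : S) : ∑' t, (mulCol Q)^[t] (fun _ => 1) z ≤ W z := by
  rw [ENNReal.tsum_eq_iSup_nat]
  exact iSup_le fun N => sum_survival_le h N z

/-- Foster's criterion. -/
lemma hasHittingBound_of_drift {P : S → S → ℝ≥0∞} {A : Set S} {V : S → ℝ≥0∞} {K : ℝ≥0∞}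
    (hV : ∀ z, V z ≠ ⊤) (hK : K ≠ ⊤) (hA : ∀ z ∈ A, mulCol P V z ≤ V z + K)
    (hAc : ∀ z ∉ A, 1 + mulCol P V z ≤ V z) : HasHittingBound P A := by
  classical
  -- The extra `1 + K` pays for the first step out of `A`; killing on entry to `A` keeps it from
  -- being charged again.
  refine ⟨fun z => V z + if z ∈ A then 1 + K else 0, fun z => ?_, fun z => ?_⟩
  · by_cases hz : z ∈ A <;> simp [hV z, hK, hz]
  · have key : mulCol (taboo P A) (fun z => V z + if z ∈ A then 1 + K else 0) z ≤ mulCol P V z := by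
      refine ENNReal.tsum_le_tsum fun y => ?_
      by_cases hy : y ∈ A <;> simp [taboo, hy]
    by_cases hz : z ∈ A
    · simp only [hz, if_true]
      calc _ ≤ 1 + (V z + K) := add_le_add le_rfl (key.trans (hA z hz))
        _ = _ := by ring
    · simp only [hz, if_false, add_zero]
      exact (add_le_add le_rfl key).trans (hAc z hz)

/-- If the finite set `A` is hit in finite expected time from everywhere, and each state of `A`
can move into `B` at once, then `B` is hit in finite expected time from everywhere. -/
lemma HasHittingBound.of_step {P : S → S → ℝ≥0∞} (hP : ∀ x, ∑' y, P x y = 1) {A B : Set S}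
    (hA : A.Finite) (h : HasHittingBound P A) (hAB : ∀ z ∈ A, ∃ y ∈ B, 0 < P z y) :
    HasHittingBound P B := by
  classical
  obtain ⟨W, hW, hWA⟩ := h
  choose! y hyB hy using hAB
  have hP1 : ∀ x y, P x y ≤ 1 := fun x y => (ENNReal.le_tsum y).trans (hP x).le
  -- From `z ∈ A` the chain enters `B` at once with probability `P z (y z)`. The constant `D` is so
  -- large that this chance pays for the cost `W z` of the next return to `A`; finiteness of `A`
  -- keeps `D` finite.
  obtain ⟨D, hD, hDA⟩ : ∃ D : ℝ≥0∞, D ≠ ⊤ ∧ ∀ z ∈ A, W z ≤ D * P z (y z) := by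
    refine ⟨∑ z ∈ hA.toFinset, W z / P z (y z), ?_, fun z hz => ?_⟩
    · refine ENNReal.sum_ne_top.mpr fun z hz => ENNReal.div_ne_top (hW z) ?_
      exact (hy z (by simpa using hz)).ne'
    · rw [← ENNReal.div_le_iff (hy z hz).ne' (ne_top_of_le_ne_top ENNReal.one_ne_top (hP1 _ _))]
      exact Finset.single_le_sum (f := fun z => W z / P z (y z)) (fun _ _ => zero_le)
        (by simpa using hz)
  have key : ∀ z, mulCol (taboo P B) (fun w => (if w ∈ A then 0 else W w) + D) z ≤
      mulCol (taboo P A) W z + D * ∑' w, taboo P B z w := by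
    intro z
    rw [mulCol, mulCol, ← ENNReal.tsum_mul_left, ← ENNReal.tsum_add]
    refine ENNReal.tsum_le_tsum fun w => ?_
    rw [mul_add, mul_comm D]
    refine add_le_add ?_ le_rfl
    by_cases hA : w ∈ A <;> by_cases hB : w ∈ B <;> simp [taboo, hA, hB]
  refine ⟨fun w => (if w ∈ A then 0 else W w) + D, fun z => ?_, fun z => ?_⟩
  · by_cases hz : z ∈ A <;> simp [hW z, hD, hz]
  refine (add_le_add le_rfl (key z)).trans ?_
  rw [← add_assoc]
  by_cases hz : z ∈ A
  · simp only [hz, if_true, zero_add]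
    calc _ ≤ W z + D * ∑' w, taboo P B z w := add_le_add (hWA z) le_rfl
      _ ≤ D * P z (y z) + D * ∑' w, taboo P B z w := add_le_add (hDA z hz) le_rfl
      _ = D * (P z (y z) + ∑' w, taboo P B z w) := by ring
      _ ≤ D * 1 := by
        gcongr
        rw [← hP z, ← tsum_ite_eq (y z) (fun w => P z w), ← ENNReal.tsum_add]
        refine ENNReal.tsum_le_tsum fun w => ?_
        by_cases hw : w = y z
        · subst hw; simp [taboo, hyB z hz]
        · simp only [hw, if_false, zero_add]
          exact Set.indicator_le_self _ _ w
      _ = D := mul_one D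
  · simp only [hz, if_false]
    refine add_le_add (hWA z) ?_
    calc _ ≤ D * ∑' w, P z w := by
          gcongr with w
          exact Set.indicator_le_self _ _ w
      _ = D := by rw [hP, mul_one]

lemma HasHittingBound.of_reflTransGen {P : S → S → ℝ≥0∞} (hP : ∀ x, ∑' y, P x y = 1) {u v : S}
    (h : HasHittingBound P {u}) (huv : Relation.ReflTransGen (fun x y => 0 < P x y) u v) :
    HasHittingBound P {v} := by
  induction huv with
  | refl => exact h
  | tail _ hbc ih => exact ih.of_step hP (Set.finite_singleton _) (by simpa using hbc)

/-! ### Excursions and stationary distributions. -/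

lemma rowMul_tsum (Q : S → S → ℝ≥0∞) (p : ℕ → S → ℝ≥0∞) (y : S) :
    rowMul Q (fun x => ∑' t, p t x) y = ∑' t, rowMul Q (p t) y := by
  simp only [rowMul, ← ENNReal.tsum_mul_right]
  exact ENNReal.tsum_comm

/-- The occupation measure of an excursion from `o`. -/
noncomputable def excursionMeasure (P : S → S → ℝ≥0∞) (o : S) (y : S) : ℝ≥0∞ :=
  ∑' t, (rowMul (taboo P {o}))^[t] (Set.indicator {o} 1) y

lemma excursionMeasure_eq (P : S → S → ℝ≥0∞) (o y : S) :
    excursionMeasure P o y =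
      Set.indicator {o} 1 y + rowMul (taboo P {o}) (excursionMeasure P o) y := by
  have h : rowMul (taboo P {o}) (excursionMeasure P o) y =
      ∑' t, (rowMul (taboo P {o}))^[t + 1] (Set.indicator {o} 1) y := by
    simp only [Function.iterate_succ_apply']
    exact rowMul_tsum _ _ _
  rw [h, excursionMeasure, tsum_eq_zero_add' ENNReal.summable]
  rfl

lemma rowMul_taboo_self (P : S → S → ℝ≥0∞) (o : S) (p : S → ℝ≥0∞) :
    rowMul (taboo P {o}) p o = 0 := by simp [rowMul, taboo]

lemma rowMul_taboo_of_ne (P : S → S → ℝ≥0∞) {o y : S} (h : y ≠ o) (p : S → ℝ≥0∞) :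
    rowMul (taboo P {o}) p y = rowMul P p y := by simp [rowMul, taboo, h]

lemma tsum_excursionMeasure_le (P : S → S → ℝ≥0∞) (o : S) {W : S → ℝ≥0∞}
    (h : ∀ z, 1 + mulCol (taboo P {o}) W z ≤ W z) : ∑' y, excursionMeasure P o y ≤ W o := by
  classical
  calc ∑' y, excursionMeasure P o y
      = ∑' t, ∑' y, (rowMul (taboo P {o}))^[t] (Set.indicator {o} 1) y := ENNReal.tsum_comm
    _ = ∑' t, (mulCol (taboo P {o}))^[t] (fun _ => 1) o := by
        refine tsum_congr fun t => ?_
        rw [tsum_rowMul_iterate, tsum_eq_single o]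
        · simp
        · intro x hx; simp [hx]
    _ ≤ W o := tsum_survival_le h o

lemma excursionMeasure_self (P : S → S → ℝ≥0∞) (o : S) : excursionMeasure P o o = 1 := by
  rw [excursionMeasure_eq, rowMul_taboo_self]; simp

/-- The occupation measure of an excursion is invariant. -/
lemma rowMul_excursionMeasure {P : S → S → ℝ≥0∞} (hP : ∀ x, ∑' y, P x y = 1) {o : S}
    (h : ∑' y, excursionMeasure P o y ≠ ⊤) :
    rowMul P (excursionMeasure P o) = excursionMeasure P o := by
  classical
  set ν := excursionMeasure P o with hν
  -- Killing changes only the column of `o`, so invariance elsewhere is the recursion for `ν`. At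
  -- `o` it follows from conservation of the finite total mass.
  have hne : ∀ y, y ≠ o → rowMul P ν y = ν y := by
    intro y hy
    rw [← rowMul_taboo_of_ne P hy, hν]
    conv_rhs => rw [excursionMeasure_eq]
    simp [hy]
  funext y
  by_cases hy : y = o
  · subst hy
    have hmass : ∑' z, rowMul P ν z = ∑' z, ν z := by
      have := tsum_rowMul_mul P ν (fun _ => 1)
      simpa [mulCol, hP] using this
    rw [ENNReal.tsum_eq_add_tsum_ite y, ENNReal.tsum_eq_add_tsum_ite (f := ν) y] at hmass
    have hrest : (∑' z, if z = y then 0 else rowMul P ν z) = ∑' z, if z = y then 0 else ν z := by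
      refine tsum_congr fun z => ?_
      split_ifs with hz
      · rfl
      · exact hne z hz
    rw [hrest] at hmass
    refine (ENNReal.add_left_inj ?_).mp hmass
    refine ne_top_of_le_ne_top h (ENNReal.tsum_le_tsum fun z => ?_)
    split_ifs <;> simp
  · exact hne y hy

/-- A finite invariant measure is a multiple of the occupation measure of an excursion. -/
lemma eq_mul_excursionMeasure {P : S → S → ℝ≥0∞} (hP : ∀ x, ∑' y, P x y = 1) {o : S}
    (h : HasHittingBound P {o}) {p : S → ℝ≥0∞} (hp : ∑' x, p x ≠ ⊤) (hinv : rowMul P p = p) (y : S) :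
    p y = p o * excursionMeasure P o y := by
  classical
  obtain ⟨W, hW, hWb⟩ := h
  set Q := taboo P {o} with hQ
  set δ : S → ℝ≥0∞ := Set.indicator {o} 1 with hδ
  -- Decomposition at the last visit to `o`: iterating this yields the partial sums of the excursion
  -- measure plus the mass that has avoided `o` for `t` steps.
  have hstep : ∀ y, p y = p o * δ y + rowMul Q p y := by
    intro y
    by_cases hy : y = o
    · subst hy; simp [hδ, hQ, rowMul_taboo_self]
    · rw [hQ, rowMul_taboo_of_ne P hy, hinv]; simp [hδ, hy]
  have hlin : ∀ (a : ℝ≥0∞) (f g : S → ℝ≥0∞) (t : ℕ) (y : S),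
      (rowMul Q)^[t] (fun x => a * f x + g x) y =
        a * (rowMul Q)^[t] f y + (rowMul Q)^[t] g y := by
    intro a f g t
    induction t generalizing f g with
    | zero => intro y; rfl
    | succ t ih =>
      intro y
      simp only [Function.iterate_succ_apply]
      rw [← ih]
      refine congrArg (fun q => (rowMul Q)^[t] q y) (funext fun x => ?_)
      simp only [rowMul, ← ENNReal.tsum_mul_left, ← ENNReal.tsum_add]
      exact tsum_congr fun w => by ring
  have hiter : ∀ t y, p y = p o * ∑ s ∈ Finset.range t, (rowMul Q)^[s] δ y +
      (rowMul Q)^[t] p y := by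
    intro t
    induction t with
    | zero => simp
    | succ t ih =>
      intro y
      have h1 : (rowMul Q)^[t] p y =
          p o * (rowMul Q)^[t] δ y + (rowMul Q)^[t + 1] p y := by
        conv_lhs => rw [show p = fun x => p o * δ x + rowMul Q p x from funext hstep]
        rw [hlin, Function.iterate_succ_apply]
      rw [Finset.sum_range_succ, mul_add, add_assoc, ← h1]
      exact ih y
  have hrem : Filter.Tendsto (fun t => (rowMul Q)^[t] p y) Filter.atTop (nhds 0) := by
    have hsum : Filter.Tendsto (fun t => ∑' x, p x * (mulCol Q)^[t] (fun _ => 1) x) Filter.atTop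
        (nhds 0) := by
      -- Sums become integrals against counting measure, so dominated convergence applies, with the
      -- summable `p` as dominating function.
      let _ : MeasurableSpace S := ⊤
      have hu : ∀ t x, (mulCol Q)^[t] (fun _ => 1) x ≤ 1 := by
        intro t
        induction t with
        | zero => intro x; rfl
        | succ t ih =>
          intro x
          rw [Function.iterate_succ_apply']
          refine (mulCol_mono Q ih x).trans ?_
          refine le_trans ?_ (hP x).le
          refine ENNReal.tsum_le_tsum fun y => ?_
          rw [mul_one]
          exact Set.indicator_le_self _ _ y
      have h0 : ∀ x, Filter.Tendsto (fun t => (mulCol Q)^[t] (fun _ => 1) x) Filter.atTop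
          (nhds 0) := fun x => ENNReal.tendsto_atTop_zero_of_tsum_ne_top
        (ne_top_of_le_ne_top (hW x) (tsum_survival_le hWb x))
      have := MeasureTheory.tendsto_lintegral_of_dominated_convergence
        (μ := MeasureTheory.Measure.count) (F := fun t x => p x * (mulCol Q)^[t] (fun _ => 1) x)
        (f := fun _ => 0) p (fun _ => measurable_from_top)
        (fun t => Filter.Eventually.of_forall fun x => mul_le_of_le_one_right' (hu t x))
        (by rwa [MeasureTheory.lintegral_count])
        (Filter.Eventually.of_forall fun x => by
          simpa using ENNReal.Tendsto.const_mul (h0 x)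
            (Or.inr (ne_top_of_le_ne_top hp (ENNReal.le_tsum x))))
      simpa [MeasureTheory.lintegral_count] using this
    refine tendsto_of_tendsto_of_tendsto_of_le_of_le tendsto_const_nhds hsum
      (fun _ => zero_le) fun t => ?_
    rw [← tsum_rowMul_iterate]
    exact ENNReal.le_tsum y
  have hlim : Filter.Tendsto (fun t => p o * ∑ s ∈ Finset.range t, (rowMul Q)^[s] δ y +
      (rowMul Q)^[t] p y) Filter.atTop (nhds (p o * excursionMeasure P o y + 0)) := by
    refine Filter.Tendsto.add ?_ hrem
    refine ENNReal.Tendsto.const_mul (ENNReal.tendsto_nat_tsum _) (Or.inr ?_)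
    exact ne_top_of_le_ne_top hp (ENNReal.le_tsum o)
  rw [add_zero] at hlim
  refine tendsto_nhds_unique (tendsto_const_nhds.congr fun t => hiter t y) hlim

/-- If `o` is hit in finite expected time from everywhere, there is exactly one stationary
distribution. -/
lemma existsUnique_stationary {P : S → S → ℝ≥0∞} (hP : ∀ x, ∑' y, P x y = 1) {o : S}
    (h : HasHittingBound P {o}) : ∃! p : PMF S, ∀ y, ∑' x, p x * P x y = p y := by
  set ν := excursionMeasure P o
  have hν : ∑' y, ν y ≠ ⊤ := by
    obtain ⟨W, hW, hWb⟩ := h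
    exact ne_top_of_le_ne_top (hW o) (tsum_excursionMeasure_le P o hWb)
  have hν0 : ∑' y, ν y ≠ 0 := by
    intro h0
    exact one_ne_zero ((excursionMeasure_self P o).symm.trans (ENNReal.tsum_eq_zero.mp h0 o))
  refine ⟨PMF.normalize ν hν0 hν, fun y => ?_, fun p hp => ?_⟩
  · simp only [PMF.normalize_apply]
    rw [← show rowMul P ν y = ν y from congrFun (rowMul_excursionMeasure hP hν) y, rowMul,
      ← ENNReal.tsum_mul_right]
    exact tsum_congr fun x => by ring
  · have hpν := eq_mul_excursionMeasure hP h (p := p) (by simp [p.tsum_coe]) (funext hp)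
    have hpo : p o * ∑' y, ν y = 1 := by
      rw [← ENNReal.tsum_mul_left, ← p.tsum_coe]
      exact tsum_congr fun y => (hpν y).symm
    ext y
    rw [PMF.normalize_apply, hpν y, ENNReal.eq_inv_of_mul_eq_one_left hpo, mul_comm]

end DiscreteChain

/-! ### Load vectors and the transitions of one round. -/

namespace TwoChoice
open MeasureTheory DiscreteChain

variable {n : ℕ}

lemma sum_toLoadVector {M : Type*} [AddCommMonoid M] (f : ℕ → M) (z : Fin n → ℕ) :
    ∑ i, f ((toLoadVector z).1 i) = ∑ i, f (z i) :=
  Equiv.sum_comp (Fin.revPerm.trans (Tuple.sort z)) fun i => f (z i)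

lemma toLoadVector_coe (x : LoadVector n) : toLoadVector x.1 = x := by
  have hmono : Monotone (x.1 ∘ (Fin.revPerm : Equiv.Perm (Fin n))) :=
    fun _ _ h => x.2 (Fin.rev_le_rev.mpr h)
  refine Subtype.ext (funext fun i => ?_)
  have := congrFun (Tuple.comp_sort_eq_comp_iff_monotone.mpr hmono) (Fin.rev i)
  simpa [toLoadVector] using this.symm

/-- The total load. -/
def totalLoad (x : LoadVector n) : ℕ := ∑ i, x.1 i

lemma finite_totalLoad_le (k : ℕ) : {x : LoadVector n | totalLoad x ≤ k}.Finite := by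
  refine Set.Finite.subset ((Set.finite_Iic (fun _ : Fin n => k)).preimage
    Subtype.val_injective.injOn) fun x hx i => ?_
  exact (Finset.single_le_sum (fun _ _ => Nat.zero_le _) (Finset.mem_univ i)).trans hx

/-- A load vector that dominates the loads after the deletions by at most `n` balls in total is
the result of some round. -/
lemma exists_step_eq [NeZero n] (x y : LoadVector n) (hle : ∀ i, x.1 i - 1 ≤ y.1 i)
    (hsum : ∑ i, (y.1 i - (x.1 i - 1)) ≤ n) : ∃ r, step x r = y := by
  classical
  set d : Fin n → ℕ := fun i => y.1 i - (x.1 i - 1) with hd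
  obtain ⟨e⟩ : Nonempty ((Σ i, Fin (d i)) ↪ Fin n) :=
    Function.Embedding.nonempty_of_card_le (by simpa using hsum)
  -- Distinct generators serve the `d i` balls required in each bin `i`. A ball that queries the
  -- same bin twice lands there whatever the loads are; all other generators stay idle.
  let r : Round n := fun g => if h : ∃ s, e s = g then (true, h.choose.1, h.choose.1)
    else (false, 0, 0)
  have hr : ∀ s, r (e s) = (true, s.1, s.1) := by
    intro s
    have h : ∃ s', e s' = e s := ⟨s, rfl⟩
    have hs : h.choose = s := e.injective h.choose_spec
    simp only [r, dif_pos h, hs]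
  refine ⟨r, ?_⟩
  conv_rhs => rw [← toLoadVector_coe y]
  unfold step
  congr 1
  funext i
  have hset : (Finset.univ.filter fun g : Fin n => (r g).1 = true ∧
      leastLoaded (afterDeletion x) (r g).2.1 (r g).2.2 = i) =
      (Finset.univ : Finset (Fin (d i))).map
        ((Function.Embedding.sigmaMk (β := fun i => Fin (d i)) i).trans e) := by
    ext g
    simp only [Finset.mem_filter, Finset.mem_univ, true_and, Finset.mem_map,
      Function.Embedding.trans_apply, Function.Embedding.sigmaMk_apply]
    constructor
    · rintro ⟨h1, h2⟩
      by_cases h : ∃ s, e s = g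
      · obtain ⟨⟨j, a⟩, rfl⟩ := h
        rw [hr] at h2
        simp only [leastLoaded, lt_irrefl, if_false, max_self] at h2
        subst h2
        exact ⟨a, rfl⟩
      · simp only [r, dif_neg h, Bool.false_eq_true] at h1
    · rintro ⟨a, rfl⟩
      rw [hr]
      simp [leastLoaded]
  rw [hset, Finset.card_map, Finset.card_univ, Fintype.card_fin]
  have := hle i
  simp only [afterDeletion, hd]
  omega

section Law

variable [NeZero n] (lam : unitInterval)

instance : IsProbabilityMeasure (generatorLaw n lam) := by unfold generatorLaw; infer_instance
instance : IsProbabilityMeasure (roundLaw n lam) := by unfold roundLaw; infer_instance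
instance : IsProbabilityMeasure (choicesLaw n lam) := by unfold choicesLaw; infer_instance

lemma roundLaw_singleton_pos {lam : unitInterval} (h0 : 0 < lam) (h1 : lam < 1) (r : Round n) :
    0 < roundLaw n lam {r} := by
  have hb : ∀ b, 0 < ProbabilityTheory.bernoulliMeasure true false lam {b} := by
    rintro (_ | _)
    · have : 0 < unitInterval.toNNReal (unitInterval.symm lam) := by
        rw [← NNReal.coe_pos, unitInterval.coe_toNNReal, unitInterval.coe_symm_eq]
        exact sub_pos.mpr h1
      simpa [ProbabilityTheory.bernoulliMeasure_def] using this
    · have : 0 < unitInterval.toNNReal lam := by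
        rw [← NNReal.coe_pos, unitInterval.coe_toNNReal]
        exact h0
      simpa [ProbabilityTheory.bernoulliMeasure_def] using this
  have hu : ∀ i : Fin n, 0 < (PMF.uniformOfFintype (Fin n)).toMeasure {i} := by
    intro i
    rw [PMF.toMeasure_apply_singleton _ _ (measurableSet_singleton i)]
    simp
  have hg : ∀ c, 0 < generatorLaw n lam {c} := by
    rintro ⟨b, i, j⟩
    rw [generatorLaw, ← Set.singleton_prod_singleton, Measure.prod_prod,
      ← Set.singleton_prod_singleton, Measure.prod_prod]
    exact ENNReal.mul_pos (hb b).ne' (ENNReal.mul_pos (hu i).ne' (hu j).ne').ne'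
  rw [roundLaw, Measure.pi_singleton]
  exact CanonicallyOrderedAdd.prod_pos.mpr fun g _ => hg _

lemma transProb_step_pos {lam : unitInterval} (h0 : 0 < lam) (h1 : lam < 1) (x : LoadVector n)
    (r : Round n) : 0 < transProb lam x (step x r) :=
  (roundLaw_singleton_pos h0 h1 r).trans_le (measure_mono (by simp))

lemma mulCol_transProb (f : LoadVector n → ℝ≥0∞) (x : LoadVector n) :
    mulCol (transProb lam) f x = ∫⁻ r, f (step x r) ∂roundLaw n lam := by
  have hm : Measurable (step x) := measurable_of_countable _
  rw [← lintegral_map (f := f) (measurable_of_countable _) hm, lintegral_countable']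
  refine tsum_congr fun y => ?_
  rw [Measure.map_apply hm (measurableSet_singleton y), mul_comm]
  rfl

lemma tsum_transProb (x : LoadVector n) : ∑' y, transProb lam x y = 1 := by
  simpa [mulCol] using mulCol_transProb lam (fun _ => 1) x

lemma exists_transProb_pos_totalLoad_lt {lam : unitInterval} (h0 : 0 < lam) (h1 : lam < 1)
    (x : LoadVector n) : ∃ y, totalLoad y ≤ totalLoad x - 1 ∧ 0 < transProb lam x y := by
  refine ⟨step x fun _ => (false, 0, 0), ?_, transProb_step_pos h0 h1 _ _⟩
  have h : totalLoad (step x fun _ => (false, 0, 0)) = ∑ i, (x.1 i - 1) := by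
    simpa [step, afterDeletion, totalLoad] using sum_toLoadVector id (fun i => x.1 i - 1)
  rw [h]
  by_cases hx : ∃ i, x.1 i ≠ 0
  · obtain ⟨i, hi⟩ := hx
    have : ∑ i, (x.1 i - 1) < ∑ i, x.1 i :=
      Finset.sum_lt_sum (fun j _ => Nat.sub_le _ _) ⟨i, Finset.mem_univ i, by omega⟩
    unfold totalLoad
    omega
  · push Not at hx
    simp [hx]

end Law

/-! ### Pathwise bounds for the quadratic potential. -/

lemma two_mul_leastLoaded_le (y : Fin n → ℕ) (i j : Fin n) :
    2 * y (leastLoaded y i j) ≤ y i + y j := by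
  unfold leastLoaded
  split_ifs with h1 h2
  · omega
  · omega
  · rcases max_choice i j with h | h <;> rw [h] <;> omega

/-- The quadratic potential. -/
def sqLoad (x : LoadVector n) : ℕ := ∑ i, x.1 i ^ 2

/-- In the expansion of `(y i + B i) ^ 2`, the cross terms are regrouped ball by ball, and each
ball's share is at most the sum of its two queried loads. At most `n` balls fall into a bin, so the
`B i ^ 2` add up to at most `n ^ 3`. -/
lemma sqLoad_step_le (x : LoadVector n) (r : Round n) :
    sqLoad (step x r) ≤ ∑ i, afterDeletion x i ^ 2 +
      ∑ g, (if (r g).1 = true then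
        afterDeletion x (r g).2.1 + afterDeletion x (r g).2.2 else 0) + n ^ 3 := by
  classical
  set y := afterDeletion x
  set B : Fin n → ℕ := fun i => (Finset.univ.filter fun g : Fin n =>
      (r g).1 = true ∧ leastLoaded y (r g).2.1 (r g).2.2 = i).card with hB
  have h1 : sqLoad (step x r) = ∑ i, (y i + B i) ^ 2 := sum_toLoadVector (fun k => k ^ 2) _
  have h2 : ∑ i, (y i + B i) ^ 2 = ∑ i, y i ^ 2 + ∑ i, 2 * y i * B i + ∑ i, B i ^ 2 := by
    rw [← Finset.sum_add_distrib, ← Finset.sum_add_distrib]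
    exact Finset.sum_congr rfl fun i _ => by ring
  have h3 : ∑ i, B i ^ 2 ≤ n ^ 3 := by
    calc ∑ i, B i ^ 2 ≤ ∑ _i : Fin n, n ^ 2 := by
          refine Finset.sum_le_sum fun i _ => Nat.pow_le_pow_left ?_ 2
          exact (Finset.card_filter_le _ _).trans (by simp)
      _ = n ^ 3 := by simp; ring
  have h4 : ∑ i, 2 * y i * B i ≤
      ∑ g, (if (r g).1 = true then y (r g).2.1 + y (r g).2.2 else 0) := by
    simp only [hB, Finset.card_filter, Finset.mul_sum]
    rw [Finset.sum_comm]
    refine Finset.sum_le_sum fun g _ => ?_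
    by_cases hg : (r g).1 = true
    · simpa [hg] using two_mul_leastLoaded_le y (r g).2.1 (r g).2.2
    · simp [hg]
  rw [h1, h2]
  gcongr

lemma sum_afterDeletion_sq_le (x : LoadVector n) :
    ∑ i, afterDeletion x i ^ 2 + 2 * ∑ i, afterDeletion x i ≤ sqLoad x := by
  rw [Finset.mul_sum, ← Finset.sum_add_distrib]
  refine Finset.sum_le_sum fun i _ => ?_
  simp only [afterDeletion]
  cases x.1 i with
  | zero => simp
  | succ k => simp only [Nat.add_sub_cancel]; nlinarith

lemma totalLoad_le_sum_afterDeletion (x : LoadVector n) :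
    totalLoad x ≤ ∑ i, afterDeletion x i + n := by
  calc totalLoad x ≤ ∑ i, (afterDeletion x i + 1) :=
        Finset.sum_le_sum fun i _ => by simp only [afterDeletion]; omega
    _ = _ := by simp [Finset.sum_add_distrib]

/-! ### Sample paths and return times. -/

/-- Prepending a round to a sequence of rounds. -/
def consRound (p : Round n × (ℕ → Round n)) : ℕ → Round n
  | 0 => p.1
  | t + 1 => p.2 t

lemma measurable_consRound : Measurable (consRound (n := n)) := by
  refine measurable_pi_iff.mpr fun t => ?_
  cases t with
  | zero => exact measurable_fst
  | succ t => exact (measurable_pi_apply t).comp measurable_snd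

lemma process_consRound (z : LoadVector n) (p : Round n × (ℕ → Round n)) (t : ℕ) :
    process z (consRound p) (t + 1) = process (step z p.1) p.2 t := by
  induction t with
  | zero => rfl
  | succ t ih => rw [process, ih]; rfl

lemma measurable_process (z : LoadVector n) (t : ℕ) : Measurable fun ω => process z ω t := by
  induction t with
  | zero => exact measurable_const
  | succ t ih =>
    have : Measurable fun q : LoadVector n × Round n => step q.1 q.2 := measurable_of_countable _
    exact this.comp (ih.prodMk (measurable_pi_apply t))

/-- The sequences of choices for which the process started in `z` avoids `x` at the times
`1, …, t`. -/
def avoids (z x : LoadVector n) (t : ℕ) : Set (ℕ → Round n) :=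
  {ω | ∀ s < t, process z ω (s + 1) ≠ x}

lemma measurableSet_avoids (z x : LoadVector n) (t : ℕ) : MeasurableSet (avoids z x t) := by
  have : avoids z x t = ⋂ s ∈ Set.Iio t, (fun ω => process z ω (s + 1)) ⁻¹' {x}ᶜ := by
    ext; simp [avoids]
  rw [this]
  exact MeasurableSet.biInter (Set.to_countable _) fun s _ =>
    measurable_process z _ (measurableSet_singleton x).compl

/-- The tail-sum formula, which turns an expected time into a sum of survival probabilities. -/
lemma toENNReal_eq_tsum_lt (T : ℕ∞) :
    (T : ℝ≥0∞) = ∑' t : ℕ, if (t : ℕ∞) < T then (1 : ℝ≥0∞) else 0 := by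
  induction T using ENat.recTopCoe with
  | top => simp
  | coe k =>
    rw [tsum_eq_sum (s := Finset.range k)]
    · rw [Finset.sum_congr rfl (g := fun _ => 1)]
      · simp
      · intro t ht; simpa using ht
    · intro t ht; simpa using ht

lemma lt_returnTime_iff (x : LoadVector n) (ω : ℕ → Round n) (t : ℕ) :
    (t : ℕ∞) < returnTime x ω ↔ ω ∈ avoids x x t := by
  constructor
  · intro h s hs hx
    have : returnTime x ω ≤ ((s + 1 : ℕ) : ℕ∞) := iInf₂_le (s + 1) ⟨by omega, hx⟩
    have := h.trans_le this
    norm_cast at this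
    omega
  · intro h
    rw [← ENat.add_one_le_iff (ENat.natCast_ne_top t)]
    refine le_iInf₂ fun s hs => ?_
    obtain ⟨s, rfl⟩ : ∃ s', s = s' + 1 := ⟨s - 1, by omega⟩
    have : t ≤ s := by
      by_contra hlt
      exact h s (by omega) hs.2
    exact_mod_cast Nat.succ_le_succ this

/-! ### Expected drift and the hitting bound for the empty system. -/

section Law

variable [NeZero n] (lam : unitInterval)

lemma lintegral_uniform (f : Fin n → ℝ≥0∞) :
    ∫⁻ i, f i ∂(PMF.uniformOfFintype (Fin n)).toMeasure = (∑ i, f i) / n := by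
  rw [lintegral_fintype, ENNReal.div_eq_inv_mul, Finset.mul_sum]
  refine Finset.sum_congr rfl fun i _ => ?_
  rw [PMF.toMeasure_apply_singleton _ _ (measurableSet_singleton i)]
  simp [mul_comm]

lemma lintegral_generatorLaw (f : Fin n → ℝ≥0∞) :
    ∫⁻ c, (if c.1 = true then f c.2.1 + f c.2.2 else 0) ∂generatorLaw n lam =
      unitInterval.toNNReal lam * (2 * ((∑ i, f i) / n)) := by
  rw [generatorLaw, lintegral_prod _ (measurable_of_countable _).aemeasurable,
    ProbabilityTheory.bernoulliMeasure_def, lintegral_add_measure, lintegral_smul_measure,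
    lintegral_smul_measure, lintegral_dirac, lintegral_dirac]
  have : ∫⁻ c : Fin n × Fin n, f c.1 + f c.2 ∂((PMF.uniformOfFintype (Fin n)).toMeasure.prod
      (PMF.uniformOfFintype (Fin n)).toMeasure) = 2 * ((∑ i, f i) / n) := by
    rw [lintegral_prod _ (measurable_of_countable _).aemeasurable]
    simp only [lintegral_add_left (measurable_of_countable _), lintegral_uniform,
      lintegral_const, measure_univ, mul_one]
    ring
  simp [this, ENNReal.smul_def]

/-- A uniform query sees the average of `f`; the `n` generators cancel the factor `1 / n`. -/
lemma lintegral_roundLaw_sum (f : Fin n → ℝ≥0∞) :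
    ∫⁻ r, ∑ g, (if (r g).1 = true then f (r g).2.1 + f (r g).2.2 else 0) ∂roundLaw n lam =
      unitInterval.toNNReal lam * (2 * ∑ i, f i) := by
  rw [lintegral_finsetSum _ fun _ _ => measurable_of_countable _]
  have h : ∀ g : Fin n, ∫⁻ r : Round n,
      (if (r g).1 = true then f (r g).2.1 + f (r g).2.2 else 0) ∂roundLaw n lam =
      unitInterval.toNNReal lam * (2 * ((∑ i, f i) / n)) := by
    intro g
    rw [← lintegral_generatorLaw]
    exact (measurePreserving_eval (fun _ : Fin n => generatorLaw n lam) g).lintegral_comp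
      (f := fun c => if c.1 = true then f c.2.1 + f c.2.2 else 0) (measurable_of_countable _)
  simp only [h, Finset.sum_const, Finset.card_univ, Fintype.card_fin, nsmul_eq_mul]
  have hn : (n : ℝ≥0∞) ≠ 0 := by exact_mod_cast NeZero.ne n
  rw [show (n : ℝ≥0∞) * (unitInterval.toNNReal lam * (2 * ((∑ i, f i) / n))) =
    unitInterval.toNNReal lam * (2 * ((∑ i, f i) / n * n)) by ring,
    ENNReal.div_mul_cancel hn (ENNReal.natCast_ne_top n)]

/-- The expected change of the quadratic potential in one round. -/
lemma mulCol_sqLoad_add_le (x : LoadVector n) :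
    mulCol (transProb lam) (fun z => (sqLoad z : ℝ≥0∞)) x +
        2 * unitInterval.toNNReal (unitInterval.symm lam) * totalLoad x ≤
      sqLoad x + (2 * n + n ^ 3) := by
  set y := afterDeletion x with hy
  set a : ℝ≥0∞ := ENNReal.ofNNReal (unitInterval.toNNReal lam)
  set b : ℝ≥0∞ := ENNReal.ofNNReal (unitInterval.toNNReal (unitInterval.symm lam))
  have hab : a + b = 1 := by
    simp only [a, b, ← ENNReal.coe_add]
    norm_cast
    ext
    simp
  have hE : mulCol (transProb lam) (fun z => (sqLoad z : ℝ≥0∞)) x ≤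
      ∑ i, (y i : ℝ≥0∞) ^ 2 + a * (2 * ∑ i, (y i : ℝ≥0∞)) + n ^ 3 := by
    rw [mulCol_transProb]
    calc _ ≤ ∫⁻ r, (∑ i, (y i : ℝ≥0∞) ^ 2 + ∑ g, (if (r g).1 = true then
            (y (r g).2.1 : ℝ≥0∞) + y (r g).2.2 else 0) + n ^ 3) ∂roundLaw n lam := by
          refine lintegral_mono fun r => ?_
          have h := (Nat.cast_le (α := ℝ≥0∞)).mpr (sqLoad_step_le x r)
          push_cast at h
          exact h
      _ = _ := by
          rw [lintegral_add_left (measurable_of_countable _),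
            lintegral_add_left (measurable_of_countable _),
            lintegral_roundLaw_sum lam fun i => (y i : ℝ≥0∞)]
          simp [a]
  have hsq : ∑ i, (y i : ℝ≥0∞) ^ 2 + 2 * ∑ i, (y i : ℝ≥0∞) ≤ sqLoad x := by
    exact_mod_cast sum_afterDeletion_sq_le x
  have htot : (totalLoad x : ℝ≥0∞) ≤ ∑ i, (y i : ℝ≥0∞) + n := by
    exact_mod_cast totalLoad_le_sum_afterDeletion x
  have hb : b ≤ 1 := hab ▸ le_add_self
  -- With `a = λ` and `b = 1 - λ`, the terms `a` and `b` recombine to the full `2 * ∑ y i` that the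
  -- deletions provide. Keeping the negative drift on the left avoids subtraction in `ℝ≥0∞`.
  calc _ ≤ (∑ i, (y i : ℝ≥0∞) ^ 2 + a * (2 * ∑ i, (y i : ℝ≥0∞)) + n ^ 3) +
        2 * b * (∑ i, (y i : ℝ≥0∞) + n) := by gcongr
    _ = (∑ i, (y i : ℝ≥0∞) ^ 2 + (a + b) * (2 * ∑ i, (y i : ℝ≥0∞))) + (2 * b * n + n ^ 3) := by
        ring
    _ ≤ sqLoad x + (2 * 1 * n + n ^ 3) := by
        rw [hab, one_mul]
        gcongr
    _ = _ := by rw [mul_one]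

/-- From everywhere, the empty system is reached in finite expected time. -/
lemma hasHittingBound_emptySystem {lam : unitInterval} (h0 : 0 < lam) (h1 : lam < 1) :
    HasHittingBound (transProb lam) {emptySystem n} := by
  set b : ℝ≥0∞ := ENNReal.ofNNReal (unitInterval.toNNReal (unitInterval.symm lam)) with hbdef
  have hb : 2 * b ≠ 0 := by
    have : 0 < unitInterval.toNNReal (unitInterval.symm lam) := by
      rw [← NNReal.coe_pos, unitInterval.coe_toNNReal, unitInterval.coe_symm_eq]
      exact sub_pos.mpr h1
    simp [hbdef, this.ne']
  have hbt : 2 * b ≠ ⊤ := ENNReal.mul_ne_top (by simp) (by simp [hbdef])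
  have hK : (2 * n + n ^ 3 : ℝ≥0∞) ≠ ⊤ := by exact_mod_cast ENNReal.natCast_ne_top (2 * n + n ^ 3)
  -- Above total load `M` the term `2 * b * totalLoad` exceeds the constant `2 * n + n ^ 3` by at
  -- least 1, as Foster's criterion requires.
  obtain ⟨M, hM⟩ := ENNReal.exists_nat_gt
    (ENNReal.div_ne_top (ENNReal.add_ne_top.mpr ⟨hK, ENNReal.one_ne_top⟩) hb)
  have hfar : HasHittingBound (transProb lam) {x : LoadVector n | totalLoad x ≤ M} := by
    refine hasHittingBound_of_drift (V := fun z => (sqLoad z : ℝ≥0∞)) (K := 2 * n + n ^ 3)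
      (fun z => ENNReal.natCast_ne_top _) hK (fun z _ => ?_) (fun z hz => ?_)
    · exact le_self_add.trans (mulCol_sqLoad_add_le lam z)
    · have hz' : M < totalLoad z := not_le.mp hz
      have hMz : (2 * n + n ^ 3 + 1 : ℝ≥0∞) ≤ 2 * b * totalLoad z := by
        rw [mul_comm (2 * b), ← ENNReal.div_le_iff hb hbt]
        exact hM.le.trans (by exact_mod_cast hz'.le)
      have := (add_le_add le_rfl hMz).trans (mulCol_sqLoad_add_le lam z)
      refine (ENNReal.add_le_add_iff_right hK).mp (le_trans (le_of_eq ?_) this)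
      ring
  -- A round without balls lowers a positive total load, so the target can be shrunk one level at a
  -- time.
  have hnear : ∀ k, HasHittingBound (transProb lam) {x : LoadVector n | totalLoad x ≤ k} →
      HasHittingBound (transProb lam) {x : LoadVector n | totalLoad x ≤ 0} := by
    intro k
    induction k with
    | zero => exact id
    | succ k ih =>
      refine fun h => ih (h.of_step (tsum_transProb lam) (finite_totalLoad_le _) fun z hz => ?_)
      obtain ⟨y, hy, hzy⟩ := exists_transProb_pos_totalLoad_lt h0 h1 z
      have hz' : totalLoad z ≤ k + 1 := hz
      exact ⟨y, show totalLoad y ≤ k by omega, hzy⟩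
  convert hnear M hfar using 1
  ext x
  simp [totalLoad, emptySystem, Subtype.ext_iff, funext_iff]

/-! ### The Markov property and positive recurrence. -/

lemma map_consRound :
    ((roundLaw n lam).prod (choicesLaw n lam)).map consRound = choicesLaw n lam := by
  classical
  refine Measure.eq_infinitePi _ fun s t ht => ?_
  -- Padding the cylinder with `Set.univ` makes its index set an initial segment, from which
  -- coordinate 0 splits off.
  set t' : ℕ → Set (Round n) := fun i => if i ∈ s then t i else Set.univ with ht'
  obtain ⟨N, hN⟩ : ∃ N, s ⊆ Finset.range (N + 1) := by
    refine ⟨s.sup id, fun i hi => ?_⟩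
    have := Finset.le_sup (f := id) hi
    simp only [Finset.mem_range, id] at this ⊢
    omega
  have hm : ∀ i, MeasurableSet (t' i) := fun i => Set.Finite.measurableSet (Set.toFinite _)
  have hpre : consRound (n := n) ⁻¹' Set.pi s t =
      t' 0 ×ˢ Set.pi (Finset.range N) (fun i => t' (i + 1)) := by
    have : Set.pi (s : Set ℕ) t = Set.pi (Finset.range (N + 1)) t' := by
      ext ω
      simp only [Set.mem_pi, Finset.mem_coe, ht']
      constructor
      · intro h i _
        split_ifs with hi
        · exact h i hi
        · trivial
      · intro h i hi
        have := h i (hN hi)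
        rwa [if_pos hi] at this
    rw [this]
    ext ⟨r, ω⟩
    simp only [Set.mem_preimage, Set.mem_pi, Finset.mem_coe, Finset.mem_range, Set.mem_prod]
    constructor
    · exact fun h => ⟨h 0 (by omega), fun i hi => h (i + 1) (by omega)⟩
    · rintro ⟨ha, hb⟩ (_ | i) hi
      · exact ha
      · exact hb i (by omega)
  rw [Measure.map_apply measurable_consRound, hpre, Measure.prod_prod, choicesLaw,
    Measure.infinitePi_pi _ fun i _ => hm (i + 1)]
  · rw [mul_comm, ← Finset.prod_range_succ' fun i => roundLaw n lam (t' i)]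
    rw [← Finset.prod_subset hN]
    · exact Finset.prod_congr rfl fun i hi => by simp [ht', hi]
    · intro i _ hi; simp [ht', hi]
  · exact MeasurableSet.pi s.countable_toSet fun i _ => Set.Finite.measurableSet (Set.toFinite _)

/-- First-step analysis: conditioning on the first round leaves a fresh sequence of choices, so each
round contributes one application of the killed kernel. This links the sample paths to the
certificates. -/
lemma choicesLaw_avoids (x : LoadVector n) (t : ℕ) (z : LoadVector n) :
    choicesLaw n lam (avoids z x t) = (mulCol (taboo (transProb lam) {x}))^[t] (fun _ => 1) z := by
  classical
  induction t generalizing z with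
  | zero => simp [avoids]
  | succ t ih =>
    rw [← map_consRound, Measure.map_apply measurable_consRound (measurableSet_avoids _ _ _),
      Measure.prod_apply (measurable_consRound (measurableSet_avoids _ _ _)),
      Function.iterate_succ_apply']
    have hmul : ∀ f : LoadVector n → ℝ≥0∞, mulCol (taboo (transProb lam) {x}) f z =
        mulCol (transProb lam) (fun y => if y = x then 0 else f y) z := by
      intro f
      refine tsum_congr fun y => ?_
      by_cases hy : y = x <;> simp [taboo, hy]
    rw [hmul, mulCol_transProb]
    refine lintegral_congr fun r => ?_
    have hpre : Prod.mk r ⁻¹' (consRound ⁻¹' avoids z x (t + 1)) =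
        {ω | step z r ≠ x ∧ ω ∈ avoids (step z r) x t} := by
      ext ω
      simp only [avoids, Set.mem_preimage, Set.mem_ofPred_eq, process_consRound]
      constructor
      · exact fun h => ⟨h 0 (by omega), fun s hs => h (s + 1) (by omega)⟩
      · rintro ⟨ha, hb⟩ (_ | s) hs
        · exact ha
        · exact hb s (by omega)
    rw [hpre]
    by_cases hx : step z r = x
    · simp [hx]
    · simp [hx, ← ih]

lemma positiveRecurrent_of_hasHittingBound {x : LoadVector n}
    (h : HasHittingBound (transProb lam) {x}) : PositiveRecurrent lam x := by
  classical
  obtain ⟨W, hW, hWb⟩ := h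
  have hT : ∀ ω, (returnTime x ω : ℝ≥0∞) =
      ∑' t : ℕ, (avoids x x t).indicator (fun _ => (1 : ℝ≥0∞)) ω := by
    intro ω
    rw [toENNReal_eq_tsum_lt]
    simp only [lt_returnTime_iff, Set.indicator]
  have hmeas : ∀ t, Measurable ((avoids x x t).indicator (fun _ => (1 : ℝ≥0∞))) := fun t =>
    measurable_const.indicator (measurableSet_avoids x x t)
  have hfin : ∫⁻ ω, (returnTime x ω : ℝ≥0∞) ∂choicesLaw n lam < ⊤ := by
    simp only [hT]
    rw [lintegral_tsum fun t => (hmeas t).aemeasurable]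
    simp only [lintegral_indicator (measurableSet_avoids x x _), lintegral_one,
      Measure.restrict_apply_univ, choicesLaw_avoids]
    exact (tsum_survival_le hWb x).trans_lt (hW x).lt_top
  refine ⟨?_, hfin⟩
  have hm : Measurable fun ω => (returnTime x ω : ℝ≥0∞) := by
    simp only [hT]
    exact Measurable.tsum hmeas
  rw [← measure_univ (μ := choicesLaw n lam)]
  refine measure_congr ?_
  filter_upwards [ae_lt_top hm hfin.ne] with ω hω
  have : returnTime x ω < ⊤ := by
    rw [lt_top_iff_ne_top] at hω ⊢
    simpa using hω
  exact propext ⟨fun _ => trivial, fun _ => this⟩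

end Law

/-! ### Irreducibility. -/

lemma eq_emptySystem_of_totalLoad {x : LoadVector n} (h : totalLoad x = 0) :
    x = emptySystem n := by
  refine Subtype.ext (funext fun i => ?_)
  exact Finset.sum_eq_zero_iff.mp h i (Finset.mem_univ i)

section Irreducible

variable [NeZero n] {lam : unitInterval}

lemma reachable_of_dominates (h0 : 0 < lam) (h1 : lam < 1) {x y : LoadVector n}
    (hle : ∀ i, x.1 i - 1 ≤ y.1 i) (hsum : ∑ i, (y.1 i - (x.1 i - 1)) ≤ n) :
    Reachable lam x y := by
  obtain ⟨r, rfl⟩ := exists_step_eq x y hle hsum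
  exact Relation.ReflTransGen.single (transProb_step_pos h0 h1 x r)

lemma reachable_emptySystem (h0 : 0 < lam) (h1 : lam < 1) (x : LoadVector n) :
    Reachable lam x (emptySystem n) := by
  induction hk : totalLoad x using Nat.strong_induction_on generalizing x with
  | _ k ih =>
    rcases Nat.eq_zero_or_pos k with rfl | hpos
    · rw [eq_emptySystem_of_totalLoad hk]
      exact Relation.ReflTransGen.refl
    · obtain ⟨y, hy, hxy⟩ := exists_transProb_pos_totalLoad_lt h0 h1 x
      exact Relation.ReflTransGen.head hxy (ih (totalLoad y) (by omega) y rfl)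

/-- The load vector with all balls in one bin. -/
def singleBin (n : ℕ) [NeZero n] (k : ℕ) : LoadVector n :=
  ⟨fun i => if i = 0 then k else 0, fun i j h => by
    by_cases hj : j = 0
    · have hi : i = 0 := le_antisymm (hj ▸ h) (Fin.zero_le i)
      simp [hi, hj]
    · simp [hj]⟩

/-- Two balls per round outweigh the deletion and raise the bin by one; this is where two generators
are needed. -/
lemma reachable_singleBin (h0 : 0 < lam) (h1 : lam < 1) (hn : 2 ≤ n) (k : ℕ) :
    Reachable lam (emptySystem n) (singleBin n k) := by
  induction k with
  | zero =>
    rw [eq_emptySystem_of_totalLoad (x := singleBin n 0) (by simp [totalLoad, singleBin])]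
    exact Relation.ReflTransGen.refl
  | succ k ih =>
    refine ih.trans (reachable_of_dominates h0 h1 (fun i => ?_) ?_)
    · simp only [singleBin]; split_ifs <;> omega
    · rw [Finset.sum_eq_single 0]
      · simp only [singleBin, if_true]; omega
      · intro i _ hi; simp [singleBin, hi]
      · simp

/-- One ball in a bin other than the fullest one can be traced back to the fullest bin. -/
lemma exists_predecessor (h0 : 0 < lam) (h1 : lam < 1) {y : LoadVector n}
    (hy : ∑ i ∈ Finset.univ.erase 0, y.1 i ≠ 0) :
    ∃ x : LoadVector n, ∑ i ∈ Finset.univ.erase 0, x.1 i < ∑ i ∈ Finset.univ.erase 0, y.1 i ∧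
      Reachable lam x y := by
  -- Taking the ball from the last non-empty bin keeps the loads non-increasing.
  obtain ⟨i, ⟨hi0, hipos⟩, hmax⟩ : ∃ i : Fin n, (i ≠ 0 ∧ y.1 i ≠ 0) ∧ ∀ j, i < j → y.1 j = 0 := by
    obtain ⟨i, hi, hyi⟩ := Finset.exists_ne_zero_of_sum_ne_zero hy
    obtain ⟨m, hm, hmle⟩ := (Finset.univ.filter fun j : Fin n => j ≠ 0 ∧ y.1 j ≠ 0).exists_maximal
      ⟨i, by simpa [hyi] using hi⟩
    refine ⟨m, by simpa using hm, fun j hj => ?_⟩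
    by_contra hne
    have hj0 : j ≠ 0 := fun h => absurd (Fin.zero_le m) (not_le.mpr (h ▸ hj))
    exact absurd (hmle (y := j) (by simp [hj0, hne]) hj.le) (not_le.mpr hj)
  let x : Fin n → ℕ := fun j => if j = 0 then y.1 0 + 1 else if j = i then y.1 i - 1 else y.1 j
  have hx : Antitone x := by
    intro j k hjk
    have hyjk := y.2 hjk
    have hk0 := y.2 (Fin.zero_le k)
    by_cases hj : j = 0
    · simp only [x, hj, if_true]
      split_ifs with h h'
      · exact le_rfl
      · subst h'; omega
      · omega
    · have hk : k ≠ 0 := fun h => hj (le_antisymm (h ▸ hjk) (Fin.zero_le j))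
      simp only [x, hj, hk, if_false]
      split_ifs with h h' h'
      · exact le_rfl
      · subst h; omega
      · subst h'
        rw [hmax k (lt_of_le_of_ne hjk fun h' => h h'.symm)]
        exact Nat.zero_le _
      · exact hyjk
  refine ⟨⟨x, hx⟩, ?_, reachable_of_dominates h0 h1 (fun j => ?_) ?_⟩
  · refine Finset.sum_lt_sum (fun j hj => ?_) ⟨i, by simpa using hi0, ?_⟩
    · have hj0 : j ≠ 0 := by simpa using hj
      simp only [x, hj0, if_false]
      split_ifs with h
      · subst h; omega
      · exact le_rfl
    · simp only [x, hi0, if_false, if_true]; omega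
  · simp only [x]
    split_ifs with h h'
    · subst h; omega
    · subst h'; omega
    · omega
  · have hsum : ∑ j, ((y.1 j - (x j - 1)) + if j = 0 then 1 else 0) ≤
        ∑ j, (1 + if j = i then 1 else 0) := by
      refine Finset.sum_le_sum fun j _ => ?_
      by_cases hj : j = 0
      · subst hj; simp [x]
      · by_cases hji : j = i
        · subst hji; simp [x, hj]; omega
        · simp [x, hj, hji]; omega
    simp only [Finset.sum_add_distrib, Finset.sum_ite_eq', Finset.mem_univ, if_true,
      Finset.sum_const, Finset.card_univ, Fintype.card_fin, smul_eq_mul, mul_one] at hsum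
    exact Nat.le_of_add_le_add_right hsum

lemma reachable_from_emptySystem (h0 : 0 < lam) (h1 : lam < 1) (hn : 2 ≤ n) (y : LoadVector n) :
    Reachable lam (emptySystem n) y := by
  induction hk : ∑ i ∈ Finset.univ.erase 0, y.1 i using Nat.strong_induction_on
    generalizing y with
  | _ k ih =>
    by_cases hk0 : k = 0
    · have : y = singleBin n (y.1 0) := by
        refine Subtype.ext (funext fun i => ?_)
        by_cases hi : i = 0
        · simp [singleBin, hi]
        · simpa [singleBin, hi] using
            Finset.sum_eq_zero_iff.mp (hk.trans hk0) i (by simpa using hi)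
      rw [this]
      exact reachable_singleBin h0 h1 hn _
    · obtain ⟨x, hx, hxy⟩ := exists_predecessor h0 h1 (hk.trans_ne hk0)
      exact (ih _ (hk ▸ hx) x rfl).trans hxy

end Irreducible

end TwoChoice

theorem mainTheorem4 (n : ℕ) [NeZero n] (lam : unitInterval)
    (hlam : (lam : ℝ) ∈ Set.Ico (1 / 4 : ℝ) 1) :
    (2 ≤ n → ∀ x y : TwoChoice.LoadVector n, TwoChoice.Reachable lam x y) ∧
    (∀ x : TwoChoice.LoadVector n, TwoChoice.Reachable lam (TwoChoice.emptySystem n) x →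
      TwoChoice.PositiveRecurrent lam x) ∧
    (∃! p : PMF (TwoChoice.LoadVector n), TwoChoice.Stationary lam p) := by
  have h0 : 0 < lam := Subtype.coe_lt_coe.mp (lt_of_lt_of_le (by norm_num) hlam.1)
  have h1 : lam < 1 := Subtype.coe_lt_coe.mp hlam.2
  have hP := TwoChoice.tsum_transProb (n := n) lam
  have hempty := TwoChoice.hasHittingBound_emptySystem (n := n) h0 h1
  refine ⟨fun hn x y => ?_, fun x hx => ?_, ?_⟩
  · exact (TwoChoice.reachable_emptySystem h0 h1 x).trans
      (TwoChoice.reachable_from_emptySystem h0 h1 hn y)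
  · exact TwoChoice.positiveRecurrent_of_hasHittingBound lam (hempty.of_reflTransGen hP hx)
  · exact DiscreteChain.existsUnique_stationary hP hempty
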